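/- Let $\mathsf T$ be a rigidly-compactly generated tensor-triangulated category, that is, a compactly generated triangulated category with a closed symmetric monoidal structure whose tensor product $\otimes$ and internal hom are exact in both variables, and in which the compact objects coincide with the rigid objects (those $X$ for which the natural map $\underline{\mathrm{Hom}}(X,\mathbb 1)\otimes Y\to\underline{\mathrm{Hom}}(X,Y)$ is an isomorphism for all $Y$). Write $\mathsf T^{c}$ for the full subcategory of compact objects. A functor $F\colon\mathsf T\to\mathsf{Ab}$ is coherent if it has a presentation $\mathrm{Hom}(A,-)\to\mathrm{Hom}(B,-)\to F\to 0$ with $A,B\in\mathsf T^{c}$. A full subcategory $\mathcal D\subseteq\mathsf T$ is definable if $\mathcal D=\{X: F_i(X)=0\text{ for all }i\in I\}$ for some set $\{F_i\}_{i\in I}$ of coherent functors, and $\otimes$-closed if $Y\otimes X\in\mathcal D$ for all $X\in\mathcal D$ and $Y\in\mathsf T$. A distinguished triangle $X\to Y\to Z\to\Sigma X$ is pure if $0\to\mathrm{Hom}(C,X)\to\mathrm{Hom}(C,Y)\to\mathrm{Hom}(C,Z)\to0$ is exact for all $C\in\mathsf T^{c}$; then $X\to Y$ is called a pure monomorphism.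 An object $X$ is pure injective if every pure monomorphism $X\to Y$ splits. Let $\mathsf{Zg}^{\otimes}(\mathsf T)$ be the space of isomorphism classes of nonzero indecomposable pure injective objects of $\mathsf T$ whose closed sets are the sets of points lying in a $\otimes$-closed definable subcategory, let $\mathsf{KZg}^{\otimes}(\mathsf T)$ be its Kolmogorov quotient, and let $\mathcal K$ be the set of closed points of $\mathsf{KZg}^{\otimes}(\mathsf T)$. For a coherent functor $F$ put $$(F)_\otimes^{c}=\{X\in\mathcal K: F(C\otimes X)=0\text{ for all }C\in\mathsf T^{c}\},$$ where $X$ stands for the indecomposable pure injective objects representing the point. Then the sets $(F)_\otimes^{c}$, with $F$ ranging over the coherent functors, form a basis of a topology on $\mathcal K$ (the dual topology), and $\mathcal K$ with this topology is a $T_0$-space. -/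

import Mathlib

open CategoryTheory CategoryTheory.Limits CategoryTheory.Pretriangulated MonoidalCategory
open scoped CategoryTheory.Pretriangulated.Opposite

universe v u

noncomputable section

namespace TTZiegler

section Exactness

/-- A functor between (pre)triangulated categories is exact if it can be equipped with
isomorphisms commuting it with the shifts in such a way that it sends distinguished triangles to
distinguished triangles. -/
def IsExactFunctor {C : Type*} {D : Type*} [Category* C] [Category* D]
    [Preadditive C] [HasZeroObject C] [HasShift C ℤ] [∀ n : ℤ, (shiftFunctor C n).Additive]
    [Pretriangulated C]
    [Preadditive D] [HasZeroObject D] [HasShift D ℤ] [∀ n : ℤ, (shiftFunctor D n).Additive]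
    [Pretriangulated D] (F : C ⥤ D) : Prop :=
  ∃ _ : F.CommShift ℤ, F.IsTriangulated

end Exactness

section Triangulated

variable (T : Type u) [Category.{v} T] [Preadditive T] [HasZeroObject T] [HasShift T ℤ]
  [∀ n : ℤ, (shiftFunctor T n).Additive] [Pretriangulated T]

/-- An object `C` is compact if `Hom(C, -) : T ⥤ Ab` preserves all small coproducts. -/
def IsCompactObject {T : Type u} [Category.{v} T] [Preadditive T] : ObjectProperty T :=
  fun C => ∀ J : Type v,
    PreservesColimitsOfShape (Discrete J) (preadditiveCoyoneda.obj (Opposite.op C))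

/-- A triangulated category is compactly generated if it has all small coproducts and there is a
set of compact objects `G i` such that an object `X` with `Hom(G i, Σⁿ X) = 0` for all `i` and all
integers `n` is zero. -/
class IsCompactlyGenerated : Prop where
  hasCoproducts : HasCoproducts.{v} T
  exists_generators : ∃ (ι : Type v) (G : ι → T), (∀ i, IsCompactObject (G i)) ∧
    ∀ X : T, (∀ (i : ι) (n : ℤ) (f : G i ⟶ X⟦n⟧), f = 0) → IsZero X

variable {T}

/-- A functor `F : T ⥤ Ab` is coherent if it has a presentation
`Hom(A, -) ⟶ Hom(B, -) ⟶ F ⟶ 0` with `A` and `B` compact. -/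
def IsCoherent {T : Type u} [Category.{v} T] [Preadditive T] (F : T ⥤ AddCommGrpCat.{v}) : Prop :=
  ∃ (A B : T) (f : preadditiveCoyoneda.obj (Opposite.op A) ⟶
      preadditiveCoyoneda.obj (Opposite.op B))
    (g : preadditiveCoyoneda.obj (Opposite.op B) ⟶ F) (w : f ≫ g = 0),
    IsCompactObject A ∧ IsCompactObject B ∧ (ShortComplex.mk f g w).Exact ∧ Epi g

/-- A full subcategory is definable if it consists of the common zeros of a set of coherent
functors. -/
def IsDefinable {T : Type u} [Category.{v} T] [Preadditive T] (D : ObjectProperty T) : Prop :=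
  ∃ (ι : Type v) (F : ι → T ⥤ AddCommGrpCat.{v}), (∀ i, IsCoherent (F i)) ∧
    ∀ X : T, D X ↔ ∀ i, IsZero ((F i).obj X)

variable (T) in
/-- The restricted Yoneda embedding `X ↦ Hom(-, X)`, restricted to the compact objects. Its values
are additive functors, and exactness of additive functors is computed in all functors. -/
def restrictedYoneda : T ⥤ (IsCompactObject (T := T)).FullSubcategoryᵒᵖ ⥤ AddCommGrpCat.{v} :=
  preadditiveYoneda ⋙
    (Functor.whiskeringLeft _ _ _).obj (IsCompactObject (T := T)).ι.op

instance : (restrictedYoneda T).PreservesZeroMorphisms where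
  map_zero X Y := by
    ext C a
    exact comp_zero

/-- A distinguished triangle `X ⟶ Y ⟶ Z ⟶ ΣX` is pure if restricted Yoneda sends `X ⟶ Y ⟶ Z` to a
short exact sequence. -/
def IsPureTriangle (t : Triangle T) : Prop :=
  ∃ h : t ∈ distTriang T,
    ((ShortComplex.mk t.mor₁ t.mor₂ (comp_distTriang_mor_zero₁₂ t h)).map
      (restrictedYoneda T)).ShortExact

/-- A pure monomorphism is the first map of a pure triangle. -/
def IsPureMono {X Y : T} (f : X ⟶ Y) : Prop :=
  ∃ (Z : T) (g : Y ⟶ Z) (h : Z ⟶ X⟦(1 : ℤ)⟧), IsPureTriangle (Triangle.mk f g h)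

/-- An object `X` is pure injective if every pure monomorphism out of `X` splits. -/
def IsPureInjective (X : T) : Prop :=
  ∀ ⦃Y : T⦄ (f : X ⟶ Y), IsPureMono f → IsSplitMono f

variable (T) in
/-- The (nonzero) indecomposable pure injective objects. -/
def indecomposablePureInjective : ObjectProperty T :=
  fun X => Indecomposable X ∧ IsPureInjective X

variable (T) in
/-- The points of the Ziegler spectrum: isomorphism classes of indecomposable pure injective
objects. -/
def ZieglerPoint : Type u :=
  Skeleton (indecomposablePureInjective T).FullSubcategory

/-- A chosen object in the isomorphism class `p`. -/
def ZieglerPoint.obj (p : ZieglerPoint T) : T :=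
  ((fromSkeleton (indecomposablePureInjective T).FullSubcategory).obj p).obj

end Triangulated

section Tensor

variable (T : Type u) [Category.{v} T] [Preadditive T] [HasZeroObject T] [HasShift T ℤ]
  [∀ n : ℤ, (shiftFunctor T n).Additive] [Pretriangulated T] [MonoidalCategory T]

/-- The natural map `Hom(X, 𝟙) ⊗ Y ⟶ Hom(X, Y)` for the internal hom; it is adjoint to
`X ⊗ (Hom(X, 𝟙) ⊗ Y) ≅ (X ⊗ Hom(X, 𝟙)) ⊗ Y ⟶ 𝟙 ⊗ Y ≅ Y`. -/
def dualTensorToHom {T : Type u} [Category.{v} T] [MonoidalCategory T] [MonoidalClosed T]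
    (X Y : T) : (ihom X).obj (𝟙_ T) ⊗ Y ⟶ (ihom X).obj Y :=
  MonoidalClosed.curry
    ((α_ X ((ihom X).obj (𝟙_ T)) Y).inv ≫ (ihom.ev X).app (𝟙_ T) ▷ Y ≫ (λ_ Y).hom)

/-- An object `X` is rigid if `Hom(X, 𝟙) ⊗ Y ⟶ Hom(X, Y)` is an isomorphism for all `Y`. -/
def IsRigidObject {T : Type u} [Category.{v} T] [MonoidalCategory T] [MonoidalClosed T] :
    ObjectProperty T :=
  fun X => ∀ Y : T, IsIso (dualTensorToHom X Y)

/-- A triangulated category with a closed symmetric monoidal structure is a rigidly-compactly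
generated tensor-triangulated category if the tensor product and the internal hom are exact in
both variables, the category is compactly generated, and the compact and the rigid objects
coincide. -/
class IsRigidlyCompactlyGenerated [SymmetricCategory T] [MonoidalClosed T] : Prop extends
    IsCompactlyGenerated T where
  tensorLeft_exact : ∀ X : T, IsExactFunctor (tensorLeft X)
  tensorRight_exact : ∀ X : T, IsExactFunctor (tensorRight X)
  ihom_exact : ∀ X : T, IsExactFunctor (ihom X)
  ihom_contravariant_exact : ∀ Y : T,
    IsExactFunctor ((MonoidalClosed.internalHom (C := T)).flip.obj Y)
  compact_iff_rigid : ∀ X : T, IsCompactObject X ↔ IsRigidObject X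

variable {T}

/-- A full subcategory `D` is `⊗`-closed if `Y ⊗ X ∈ D` for all `X ∈ D` and all objects `Y`. -/
def IsTensorClosed {T : Type u} [Category.{v} T] [MonoidalCategory T]
    (D : ObjectProperty T) : Prop :=
  ∀ ⦃X : T⦄, D X → ∀ Y : T, D (Y ⊗ X)

/-- The Ziegler `⊗`-topology on the indecomposable pure injectives: the topology given by declaring
the sets of points lying in a `⊗`-closed definable subcategory to be closed. -/
instance zieglerTensorTopology : TopologicalSpace (ZieglerPoint T) :=
  TopologicalSpace.generateFrom
    {U | ∃ D : ObjectProperty T, IsDefinable D ∧ IsTensorClosed D ∧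
      U = {p : ZieglerPoint T | D p.obj}ᶜ}

variable (T) in
/-- The set of closed points of the Kolmogorov quotient of the `⊗`-Ziegler spectrum. -/
def KZgClosedPoints : Type u :=
  {x : SeparationQuotient (ZieglerPoint T) // IsClosed ({x} : Set (SeparationQuotient _))}

/-- The set of closed points `x` with `F(C ⊗ X) = 0` for all compact `C`, where `X` runs over the
indecomposable pure injectives in the class `x`. -/
def dualBasicOpen (F : T ⥤ AddCommGrpCat.{v}) : Set (KZgClosedPoints T) :=
  {x | ∀ p : ZieglerPoint T, SeparationQuotient.mk p = x.1 →
    ∀ C : T, IsCompactObject C → IsZero (F.obj (C ⊗ p.obj))}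

variable (T) in
/-- The dual topology on the set of closed points: it is generated by the sets `dualBasicOpen F`
for `F` coherent. -/
abbrev dualTopology : TopologicalSpace (KZgClosedPoints T) :=
  TopologicalSpace.generateFrom {U | ∃ F : T ⥤ AddCommGrpCat.{v}, IsCoherent F ∧
    U = dualBasicOpen F}

end Tensor

end TTZiegler

end

/-!
The sets `dualBasicOpen F` are stable under finite intersections, since
`(F ⊞ G)(Y) = 0` holds exactly when `F(Y) = 0` and `G(Y) = 0`, and `F ⊞ G` is coherent when `F` and
`G` are (`TTZiegler.IsCoherent.biprod`); the zero functor gives the whole space. Hence this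
subbasis is a basis.

For the `T₀` property, let `D` be a `⊗`-closed definable subcategory, the common zeros of coherent
functors `F i`. Being closed, the set of points in `D` is a union of inseparability classes, and as
`D` is `⊗`-closed every closed point represented in `D` lies in all the sets `dualBasicOpen (F i)`.
Conversely, the unit is rigid, hence compact, so evaluating the vanishing condition at `C = 𝟙` shows
that a closed point lying in all these sets is represented in `D`. Two closed points that the dual
topology does not distinguish are therefore contained in the same subbasic closed sets of the
`⊗`-Ziegler spectrum, so they are represented by inseparable points and agree in the Kolmogorov
quotient.
-/

namespace TTZiegler

section Coherent

lemma isZero_biprod_obj_iff {T : Type u} [Category.{v} T]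
    (F G : T ⥤ AddCommGrpCat.{v}) (X : T) :
    IsZero ((F ⊞ G).obj X) ↔ IsZero (F.obj X) ∧ IsZero (G.obj X) := by
  let E := (evaluation T AddCommGrpCat.{v}).obj X
  have := preservesBinaryBiproducts_of_preservesBiproducts E
  have e : (F ⊞ G).obj X ≅ F.obj X ⊞ G.obj X := E.mapBiprod F G
  rw [e.isZero_iff]
  exact biprod_isZero_iff _ _

variable {T : Type u} [Category.{v} T] [Preadditive T]

/-- Colimits commute with colimits. -/
instance isClosedUnderColimitsOfShape_preservesColimitsOfShape {J C K K' : Type*} [Category* J]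
    [Category* C] [Category* K] [Category* K'] [HasColimitsOfShape K' C] :
    (ObjectProperty.preservesColimitsOfShape K :
      ObjectProperty (J ⥤ C)).IsClosedUnderColimitsOfShape K' where
  colimitsOfShape_le := by
    rintro G ⟨h⟩
    have := h.prop_diag_obj
    have : PreservesColimitsOfShape K h.diag.flip := ⟨fun {F} ↦ ⟨fun {c} hc ↦
      ⟨evaluationJointlyReflectsColimits _
        (fun k' ↦ isColimitOfPreserves (h.diag.obj k') hc)⟩⟩⟩
    let e : h.diag.flip ⋙ colim ≅ G :=
      NatIso.ofComponents
        (fun j ↦ (colimit.isColimit (h.diag.flip.obj j)).coconePointUniqueUpToIso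
          (isColimitOfPreserves ((evaluation _ _).obj j) h.isColimit)) (by
        intro X Y f
        apply colimit.hom_ext
        intro j
        simp [IsColimit.coconePointUniqueUpToIso])
    exact preservesColimitsOfShape_of_natIso e

instance : (preadditiveCoyoneda (C := T)).Additive where
  map_add {X Y f g} := by
    ext Z h
    exact Preadditive.add_comp _ _ _ f.unop g.unop h

/-- The functor `Hom(A ⊞ B, -)` is the direct sum of `Hom(A, -)` and `Hom(B, -)`. -/
noncomputable def coyonedaBiprodIso (A B : T) [HasBinaryBiproduct A B] :
    preadditiveCoyoneda.obj (Opposite.op A) ⊞ preadditiveCoyoneda.obj (Opposite.op B) ≅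
      preadditiveCoyoneda.obj (Opposite.op (A ⊞ B)) where
  hom := biprod.desc (preadditiveCoyoneda.map biprod.fst.op)
    (preadditiveCoyoneda.map biprod.snd.op)
  inv := biprod.lift (preadditiveCoyoneda.map biprod.inl.op)
    (preadditiveCoyoneda.map biprod.inr.op)
  hom_inv_id := by
    apply biprod.hom_ext' <;> apply biprod.hom_ext <;> simp [← Functor.map_comp, ← op_comp]
  inv_hom_id := by
    rw [biprod.lift_desc, ← Functor.map_comp, ← Functor.map_comp, ← Functor.map_add,
      ← op_comp, ← op_comp, ← op_add, biprod.total, op_id,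
      CategoryTheory.Functor.map_id]

lemma IsCompactObject.biprod {A B : T} [HasBinaryBiproduct A B]
    (hA : IsCompactObject A) (hB : IsCompactObject B) : IsCompactObject (A ⊞ B) := by
  intro J
  let P : ObjectProperty (T ⥤ AddCommGrpCat.{v}) :=
    ObjectProperty.preservesColimitsOfShape (Discrete J)
  have h : P (preadditiveCoyoneda.obj (Opposite.op A) ⊞
      preadditiveCoyoneda.obj (Opposite.op B)) := by
    refine ObjectProperty.prop_of_isColimit _ (BinaryBiproduct.isColimit _ _) ?_
    rintro ⟨_ | _⟩
    · exact hA J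
    · exact hB J
  exact P.prop_of_iso (coyonedaBiprodIso A B) h

lemma biprod_map_comp_map_eq_zero {A : Type*} [Category* A] [Preadditive A]
    [HasBinaryBiproducts A] {P Q F P' Q' F' : A}
    {f : P ⟶ Q} {g : Q ⟶ F} (w : f ≫ g = 0) {f' : P' ⟶ Q'} {g' : Q' ⟶ F'} (w' : f' ≫ g' = 0) :
    biprod.map f f' ≫ biprod.map g g' = 0 := by
  ext <;> simp [reassoc_of% w, reassoc_of% w']

/-- Exactness of `P ⟶ Q ⟶ F ⟶ 0` is equivalent to `F` being a cokernel, and a direct sum of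
cokernels is a cokernel of the direct sum of the maps. -/
lemma exact_and_epi_biprod {A : Type*} [Category* A] [Abelian A] {P Q F P' Q' F' : A}
    {f : P ⟶ Q} {g : Q ⟶ F} {w : f ≫ g = 0} {f' : P' ⟶ Q'} {g' : Q' ⟶ F'} {w' : f' ≫ g' = 0}
    (h : (ShortComplex.mk f g w).Exact) [Epi g] (h' : (ShortComplex.mk f' g' w').Exact) [Epi g'] :
    (ShortComplex.mk (biprod.map f f') (biprod.map g g') 
      (biprod_map_comp_map_eq_zero w w')).Exact ∧ Epi (biprod.map g g') := by
  rw [ShortComplex.exact_and_epi_g_iff_g_is_cokernel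
    (ShortComplex.mk (biprod.map f f') (biprod.map g g') _)]
  refine ⟨CokernelCofork.IsColimit.ofπ _ _
    (fun k hk => biprod.desc (h.desc (biprod.inl ≫ k) ?_) (h'.desc (biprod.inr ≫ k) ?_))
    (fun k hk => ?_) (fun k hk m hm => ?_)⟩
  · simpa using biprod.inl ≫= hk
  · simpa using biprod.inr ≫= hk
  · ext
    · simpa using h.g_desc _ _
    · simpa using h'.g_desc _ _
  · ext
    · rw [← cancel_epi g, biprod.inl_desc, h.g_desc, ← hm]
      simp
    · rw [← cancel_epi g', biprod.inr_desc, h'.g_desc, ← hm]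
      simp

lemma IsCoherent.biprod [HasBinaryBiproducts T] {F G : T ⥤ AddCommGrpCat.{v}}
    (hF : IsCoherent F) (hG : IsCoherent G) : IsCoherent (F ⊞ G) := by
  obtain ⟨A, B, f, g, w, hA, hB, hfg, hg⟩ := hF
  obtain ⟨A', B', f', g', w', hA', hB', hfg', hg'⟩ := hG
  let eA := coyonedaBiprodIso A A'
  let eB := coyonedaBiprodIso B B'
  refine ⟨A ⊞ A', B ⊞ B', eA.inv ≫ biprod.map f f' ≫ eB.hom, eB.inv ≫ biprod.map g g', ?_,
    hA.biprod hA', hB.biprod hB', ?_⟩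
  · simp only [Category.assoc, Iso.hom_inv_id_assoc]
    rw [biprod_map_comp_map_eq_zero w w', comp_zero]
  · refine (ShortComplex.exact_and_epi_g_iff_of_iso ?_).1 (exact_and_epi_biprod hfg hfg')
    exact ShortComplex.isoMk eA eB (Iso.refl _) (by simp) (by simp)

lemma isCoherent_of_isZero {A : T} (hA : IsCompactObject A) {F : T ⥤ AddCommGrpCat.{v}}
    (hF : IsZero F) : IsCoherent F := by
  have : Epi (0 : preadditiveCoyoneda.obj (Opposite.op A) ⟶ F) := ⟨fun _ _ _ => hF.eq_of_src _ _⟩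
  refine ⟨A, A, 𝟙 _, 0, comp_zero, hA, hA, ?_, this⟩
  rw [ShortComplex.exact_iff_epi _ rfl]
  infer_instance

end Coherent

section Unit

variable {T : Type u} [Category.{v} T] [MonoidalCategory T] [MonoidalClosed T]

lemma isIso_curry_unit {X Y : T} (f : 𝟙_ T ⊗ X ⟶ Y) [IsIso f] :
    IsIso (MonoidalClosed.curry f) := by
  have : (tensorLeft (𝟙_ T)).IsEquivalence :=
    Functor.isEquivalence_of_iso (leftUnitorNatIso T).symm
  have : IsIso ((ihom.adjunction (𝟙_ T)).unit) := inferInstance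
  have : IsIso ((ihom.coev (𝟙_ T)).app X) :=
    inferInstanceAs (IsIso ((ihom.adjunction (𝟙_ T)).unit.app X))
  rw [MonoidalClosed.curry_eq]
  infer_instance

variable (T) in
lemma isRigidObject_unit : IsRigidObject (𝟙_ T) := by
  intro Y
  have : (tensorLeft (𝟙_ T)).IsEquivalence :=
    Functor.isEquivalence_of_iso (leftUnitorNatIso T).symm
  have : IsIso ((ihom.ev (𝟙_ T)).app (𝟙_ T)) :=
    inferInstanceAs (IsIso ((ihom.adjunction (𝟙_ T)).counit.app (𝟙_ T)))
  exact isIso_curry_unit _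

end Unit

section Tensor

variable {T : Type u} [Category.{v} T] [Preadditive T] [HasZeroObject T] [HasShift T ℤ]
  [∀ n : ℤ, (shiftFunctor T n).Additive] [Pretriangulated T] [MonoidalCategory T]

variable (T) in
lemma isCompactObject_unit [SymmetricCategory T] [MonoidalClosed T]
    [IsRigidlyCompactlyGenerated T] : IsCompactObject (𝟙_ T) :=
  (IsRigidlyCompactlyGenerated.compact_iff_rigid _).2 (isRigidObject_unit T)

lemma dualBasicOpen_biprod (F G : T ⥤ AddCommGrpCat.{v}) :
    dualBasicOpen (F ⊞ G) = dualBasicOpen F ∩ dualBasicOpen G := by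
  ext x
  simp only [dualBasicOpen, Set.mem_inter_iff, Set.mem_ofPred_eq, isZero_biprod_obj_iff]
  grind

lemma dualBasicOpen_of_isZero {F : T ⥤ AddCommGrpCat.{v}} (hF : IsZero F) :
    dualBasicOpen F = Set.univ :=
  Set.eq_univ_of_forall fun _ _ _ _ _ => hF.obj _

/-- A `⊗`-closed definable subcategory gives a closed set of points. -/
lemma isClosed_setOf_obj {D : ObjectProperty T} (hD : IsDefinable D) (hD' : IsTensorClosed D) :
    IsClosed {p : ZieglerPoint T | D p.obj} :=
  ⟨TopologicalSpace.isOpen_generateFrom_of_mem ⟨D, hD, hD', rfl⟩⟩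

/-- The points of a `⊗`-closed definable subcategory `D` lie in `dualBasicOpen F` for each functor
`F` vanishing on `D`. -/
lemma mem_dualBasicOpen_of_isTensorClosed {D : ObjectProperty T} (hD : IsDefinable D)
    (hD' : IsTensorClosed D) {F : T ⥤ AddCommGrpCat.{v}} (hF : ∀ X, D X → IsZero (F.obj X))
    {x : KZgClosedPoints T} {p : ZieglerPoint T} (hp : SeparationQuotient.mk p = x.1)
    (h : D p.obj) : x ∈ dualBasicOpen F := by
  intro q hq C _
  have hpq : Inseparable p q := SeparationQuotient.mk_eq_mk.1 (hp.trans hq.symm)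
  exact hF _ (hD' ((hpq.mem_closed_iff (isClosed_setOf_obj hD hD')).1 h) C)

/-- Evaluating at the compact object `𝟙` detects the vanishing of `F` on the representatives. -/
lemma isZero_obj_of_mem_dualBasicOpen (hunit : IsCompactObject (𝟙_ T))
    {F : T ⥤ AddCommGrpCat.{v}} {x : KZgClosedPoints T} (hx : x ∈ dualBasicOpen F)
    {p : ZieglerPoint T} (hp : SeparationQuotient.mk p = x.1) : IsZero (F.obj p.obj) :=
  (hx p hp _ hunit).of_iso (F.mapIso (λ_ p.obj).symm)

lemma isOpen_dualBasicOpen {F : T ⥤ AddCommGrpCat.{v}} (hF : IsCoherent F) :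
    @IsOpen _ (dualTopology T) (dualBasicOpen F) :=
  TopologicalSpace.isOpen_generateFrom_of_mem ⟨F, hF, rfl⟩

/-- Membership in a `⊗`-closed definable subcategory can be read off from the dual topology. -/
lemma obj_iff_of_inseparable (hunit : IsCompactObject (𝟙_ T)) {D : ObjectProperty T}
    (hD : IsDefinable D) (hD' : IsTensorClosed D) {x y : KZgClosedPoints T}
    (hxy : @Inseparable _ (dualTopology T) x y) {p q : ZieglerPoint T}
    (hp : SeparationQuotient.mk p = x.1) (hq : SeparationQuotient.mk q = y.1) :
    D p.obj ↔ D q.obj := by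
  let := dualTopology T
  obtain ⟨ι, F, hF, hDF⟩ := id hD
  have key : ∀ {z : KZgClosedPoints T} {r : ZieglerPoint T}, SeparationQuotient.mk r = z.1 →
      (D r.obj ↔ ∀ i, z ∈ dualBasicOpen (F i)) := fun hr =>
    ⟨fun h i => mem_dualBasicOpen_of_isTensorClosed hD hD' (fun X hX => (hDF X).1 hX i) hr h,
      fun h => (hDF _).2 fun i => isZero_obj_of_mem_dualBasicOpen hunit (h i) hr⟩
  rw [key hp, key hq]
  exact forall_congr' fun i => hxy.mem_open_iff (isOpen_dualBasicOpen (hF i))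

lemma t0Space_dualTopology (hunit : IsCompactObject (𝟙_ T)) :
    @T0Space (KZgClosedPoints T) (dualTopology T) := by
  let := dualTopology T
  refine ⟨fun x y hxy => Subtype.ext ?_⟩
  obtain ⟨p, hp⟩ := SeparationQuotient.surjective_mk x.1
  obtain ⟨q, hq⟩ := SeparationQuotient.surjective_mk y.1
  rw [← hp, ← hq, SeparationQuotient.mk_eq_mk, Inseparable,
    TopologicalSpace.nhds_generateFrom, TopologicalSpace.nhds_generateFrom]
  have h : ∀ U ∈ {U | ∃ D : ObjectProperty T, IsDefinable D ∧ IsTensorClosed D ∧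
      U = {p : ZieglerPoint T | D p.obj}ᶜ}, (p ∈ U ↔ q ∈ U) := by
    rintro _ ⟨D, hD, hD', rfl⟩
    exact not_congr (obj_iff_of_inseparable hunit hD hD' hxy hp hq)
  congr! 4
  exact Set.ext fun U => and_congr_left (h U)

open scoped ZeroObject in
lemma isTopologicalBasis_dualBasicOpen (hunit : IsCompactObject (𝟙_ T)) :
    @TopologicalSpace.IsTopologicalBasis (KZgClosedPoints T) (dualTopology T)
      {U | ∃ F : T ⥤ AddCommGrpCat.{v}, IsCoherent F ∧ U = dualBasicOpen F} := by
  let := dualTopology T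
  refine TopologicalSpace.isTopologicalBasis_of_subbasis_of_finiteInter rfl
    ⟨⟨0, isCoherent_of_isZero hunit (isZero_zero _),
      (dualBasicOpen_of_isZero (isZero_zero _)).symm⟩, ?_⟩
  rintro _ ⟨F, hF, rfl⟩ _ ⟨G, hG, rfl⟩
  exact ⟨F ⊞ G, hF.biprod hG, (dualBasicOpen_biprod F G).symm⟩

end Tensor

end TTZiegler

theorem proposition4p16 (T : Type u) [Category.{v} T] [Preadditive T] [HasZeroObject T]
    [HasShift T ℤ] [∀ n : ℤ, (shiftFunctor T n).Additive] [Pretriangulated T]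
    [CategoryTheory.IsTriangulated T]
    [MonoidalCategory T] [SymmetricCategory T] [MonoidalClosed T]
    [TTZiegler.IsRigidlyCompactlyGenerated T] :
    @TopologicalSpace.IsTopologicalBasis (TTZiegler.KZgClosedPoints T) (TTZiegler.dualTopology T)
        {U | ∃ F : T ⥤ AddCommGrpCat.{v}, TTZiegler.IsCoherent F ∧
          U = TTZiegler.dualBasicOpen F} ∧
      @T0Space (TTZiegler.KZgClosedPoints T) (TTZiegler.dualTopology T) :=
  ⟨TTZiegler.isTopologicalBasis_dualBasicOpen (TTZiegler.isCompactObject_unit T),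
    TTZiegler.t0Space_dualTopology (TTZiegler.isCompactObject_unit T)⟩
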